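/- **Setting.** Let $\{h_\theta\}_{\theta\in\Theta}$ be a finite class of hypotheses $h_\theta:\mathcal X\to\mathcal Z$, let $f:\mathcal Z\times\mathcal Y\to[0,1]$ be a loss, let $D$ be a training set of $n$ labelled samples and let $D'\subseteq D$ be a nonempty surrogate. Write $R(h,D')=\mathbb E_{(x,y)\in D'}f(h(x),y)$ for the average loss on $D'$, and let $h^*=h_{\theta^*}$ minimize $R(\cdot,D')$ over the class. Put $\Delta(z,z')=\sup_{y}|f(z,y)-f(z',y)|$, $\ell(h,h')=\mathbb E_{x\in D'}\Delta(h(x),h'(x))$ and $B(h^*,r)=\{h:\ell(h,h^*)\le r\}$. The slope asymmetry is $$K_f=\sup_{h,h'}\ \sup_{x,x'\in D'}\frac{\sup_{y}|f(h(x),y)-f(h'(x'),y)|}{\inf_{y}|f(h(x),y)-f(h'(x'),y)|}\in[0,\infty]\qquad(0/0=0),$$ which for two labels is $\sup\big|\max_y(f(h(x),y)-f(h'(x'),y))\,/\,\min_y(f(h(x),y)-f(h'(x'),y))\big|$. The disagreement coefficient is $$\vartheta_r=\mathbb E_{x\in D'}\sup_{h\in B(h^*,r)}\frac{\Delta(h(x),h^*(x))}{r},\qquad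 \vartheta=\sup_{r>0}\vartheta_r$$ (with $\vartheta_0=0$). Let $d\in\mathbb R$ and $T\in\mathbb N$ be such that the hypotheses have at most $d$ different prediction patterns on $D$ and at most $N=d/2^{n-T}$ on $D'$ (for $d=2^n$ this means at most $2^n$ on $D$ and at most $2^T$ on $D'$). Let $\delta>0$. **Learner.** Importance weighted active learning on $D'$: $H_1$ is the whole class. In round $t=1,2,\dots$ a sample $(x_t,y_t)$ is drawn uniformly from $D'$, independently of the past; its label is queried ($q_t=1$, otherwise $q_t=0$) with probability $p_t=p_t(x_t)$, where $p_t(x)=\sup_{h,h'\in H_t,\,y}\big(f(h(x),y)-f(h'(x),y)\big)$; with $L_t(h)=\frac1t\sum_{i\le t}\frac{q_i}{p_i}f(h(x_i),y_i)$ the new candidate set is $$H_{t+1}=\Big\{h\in H_t:\ L_t(h)\le\min_{h'\in H_t}L_t(h')+\sqrt{\tfrac8t\ln\tfrac{2t(t+1)N}{\delta}}\Big\}.$$ **Theorem 2.** With probability at least $1-\delta$, the following holds for all $t\ge2$ simultaneously. Let $\varepsilon_t=2\sqrt{\frac{8}{t-1}\ln\Big(\frac{2(t^2-t)\,d/2^{n-T}}{\delta}\Big)}$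 and let $r_t=\sup_{h\in H_t}\ell(h,h^*)$ be the hypothesis radius at time $t$. Then $h^*\in H_t$, every current hypothesis $h\in H_t$ satisfies $R(h,D')\le R(h^*,D')+\varepsilon_t$, and updating it into $h^*$ on $D'$ costs at most $$4\,\vartheta_{r_t}K_f\big(R(h^*,D')+\varepsilon_t\big)\ \le\ 4\,\vartheta\,K_f\big(R(h^*,D')+\varepsilon_t\big):$$ this quantity bounds both the conditional expected number $\mathbb E_{x\in D'}\,p_t(x)$ of labels queried in round $t$ given the past, and $2\,\ell(h,h^*)$ for every $h\in H_t$. (Products are taken in $[0,\infty]$ with $0\cdot\infty=0$.) -/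

import Mathlib

open MeasureTheory ProbabilityTheory
open scoped ENNReal unitInterval

noncomputable section

namespace SurrogateLearning

variable {Θ X Y Z : Type*} {n : ℕ}

/-! A training set is a family `D : Fin n → X × Y` of `n` labelled samples, and a surrogate of it is
a set `S : Finset (Fin n)` of indices, the samples that are kept. Hypotheses are parametrized by
`hyp : Θ → X → Z`, where `Z` is the space of predictions, and `f : Z → Y → ℝ` is the loss. -/

/-- The empirical risk `R(θ, D')`: the average loss of the hypothesis `θ` over the surrogate. -/
def risk (hyp : Θ → X → Z) (f : Z → Y → ℝ) (D : Fin n → X × Y) (S : Finset (Fin n)) (θ : Θ) : ℝ :=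
  (∑ i ∈ S, f (hyp θ (D i).1) (D i).2) / S.card

/-- `max_y |f(z, y) - f(z', y)|`: the largest loss difference of two predictions. -/
def lossGap (f : Z → Y → ℝ) (z z' : Z) : ℝ := ⨆ y, |f z y - f z' y|

/-- The hypothesis distance `ℓ(h, h')`: the average over the surrogate of the largest loss
difference of the predictions of the two hypotheses. -/
def hypDist (hyp : Θ → X → Z) (f : Z → Y → ℝ) (D : Fin n → X × Y) (S : Finset (Fin n))
    (θ θ' : Θ) : ℝ :=
  (∑ i ∈ S, lossGap f (hyp θ (D i).1) (hyp θ' (D i).1)) / S.card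

/-- The slope asymmetry `K_f` over the predictions that hypotheses make on the surrogate. It is
infinite if some loss difference vanishes for one label and not for another one; a pair of
predictions with equal losses contributes `0 / 0 = 0`. -/
def slopeAsymmetry (hyp : Θ → X → Z) (f : Z → Y → ℝ) (D : Fin n → X × Y) (S : Finset (Fin n)) :
    ℝ≥0∞ :=
  ⨆ (θ : Θ) (θ' : Θ) (i ∈ S) (j ∈ S),
    (⨆ y, ENNReal.ofReal |f (hyp θ (D i).1) y - f (hyp θ' (D j).1) y|) /
      (⨅ y, ENNReal.ofReal |f (hyp θ (D i).1) y - f (hyp θ' (D j).1) y|)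

theorem ratio_le (a b : ℝ) :
    (ENNReal.ofReal |a| ⊔ ENNReal.ofReal |b|) / (ENNReal.ofReal |a| ⊓ ENNReal.ofReal |b|) ≤
        ENNReal.ofReal |max a b| / ENNReal.ofReal |min a b| ∨
      (ENNReal.ofReal |a| ⊔ ENNReal.ofReal |b|) / (ENNReal.ofReal |a| ⊓ ENNReal.ofReal |b|) ≤
        ENNReal.ofReal |max (-a) (-b)| / ENNReal.ofReal |min (-a) (-b)| := by
  rcases le_total a b with h | h <;> rcases le_total |a| |b| with h' | h' <;>
    simp [h, h']

theorem le_ratio (a b : ℝ) :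
    ENNReal.ofReal |max a b| / ENNReal.ofReal |min a b| ≤
      (ENNReal.ofReal |a| ⊔ ENNReal.ofReal |b|) / (ENNReal.ofReal |a| ⊓ ENNReal.ofReal |b|) := by
  rcases le_total a b with h | h <;> simp only [h, max_eq_left, max_eq_right, min_eq_left,
    min_eq_right] <;> apply ENNReal.div_le_div <;> simp

/-- For two labels the slope asymmetry is the supremum of `|max_y (f(z,y) - f(z',y))| / |min_y
(f(z,y) - f(z',y))|`. -/
theorem slopeAsymmetry_bool (hyp : Θ → X → Z) (f : Z → Bool → ℝ) (D : Fin n → X × Bool)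
    (S : Finset (Fin n)) :
    slopeAsymmetry hyp f D S = ⨆ (θ : Θ) (θ' : Θ) (i ∈ S) (j ∈ S),
      ENNReal.ofReal |⨆ y, (f (hyp θ (D i).1) y - f (hyp θ' (D j).1) y)| /
        ENNReal.ofReal |⨅ y, (f (hyp θ (D i).1) y - f (hyp θ' (D j).1) y)| := by
  have hsup : ∀ g : Bool → ℝ, (⨆ y, g y) = max (g true) (g false) := fun g =>
    le_antisymm (ciSup_le fun y => by cases y <;> simp)
      (max_le (le_ciSup (Set.finite_range g).bddAbove true)
        (le_ciSup (Set.finite_range g).bddAbove false))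
  have hinf : ∀ g : Bool → ℝ, (⨅ y, g y) = min (g true) (g false) := fun g =>
    le_antisymm (le_min (ciInf_le (Set.finite_range g).bddBelow true)
        (ciInf_le (Set.finite_range g).bddBelow false))
      (le_ciInf fun y => by cases y <;> simp)
  unfold slopeAsymmetry
  simp only [hsup, hinf, iSup_bool_eq, iInf_bool_eq]
  apply le_antisymm
  · refine iSup_le fun θ => iSup_le fun θ' => iSup₂_le fun i hi => iSup₂_le fun j hj => ?_
    rcases ratio_le (f (hyp θ (D i).1) true - f (hyp θ' (D j).1) true)
      (f (hyp θ (D i).1) false - f (hyp θ' (D j).1) false) with h | h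
    · exact h.trans (le_iSup_of_le θ <| le_iSup_of_le θ' <| le_iSup₂_of_le i hi <|
        le_iSup₂_of_le j hj le_rfl)
    · rw [neg_sub, neg_sub] at h
      exact h.trans (le_iSup_of_le θ' <| le_iSup_of_le θ <| le_iSup₂_of_le j hj <|
        le_iSup₂_of_le i hi le_rfl)
  · refine iSup_le fun θ => iSup_le fun θ' => iSup₂_le fun i hi => iSup₂_le fun j hj => ?_
    exact (le_ratio _ _).trans (le_iSup_of_le θ <| le_iSup_of_le θ' <| le_iSup₂_of_le i hi <|
        le_iSup₂_of_le j hj le_rfl)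

/-- The ball `B(θ₀, r)` of the hypotheses at distance at most `r` from `θ₀`. -/
def hypBall (hyp : Θ → X → Z) (f : Z → Y → ℝ) (D : Fin n → X × Y) (S : Finset (Fin n))
    (θ₀ : Θ) (r : ℝ) : Set Θ :=
  {θ | hypDist hyp f D S θ θ₀ ≤ r}

/-- The disagreement coefficient at radius `r`: the average over the surrogate of the supremum over
`B(θ₀, r)` of the loss difference to `θ₀`, divided by `r`. -/
def disagreementAt (hyp : Θ → X → Z) (f : Z → Y → ℝ) (D : Fin n → X × Y) (S : Finset (Fin n))
    (θ₀ : Θ) (r : ℝ) : ℝ :=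
  (∑ i ∈ S, ⨆ θ : hypBall hyp f D S θ₀ r,
    lossGap f (hyp θ (D i).1) (hyp θ₀ (D i).1) / r) / S.card

/-- The disagreement coefficient: the supremum over all positive radii. -/
def disagreementCoeff (hyp : Θ → X → Z) (f : Z → Y → ℝ) (D : Fin n → X × Y) (S : Finset (Fin n))
    (θ₀ : Θ) : ℝ≥0∞ :=
  ⨆ (r : ℝ) (_ : 0 < r), ENNReal.ofReal (disagreementAt hyp f D S θ₀ r)

/-- The number of different prediction patterns of the hypotheses on the samples in `S`. -/
def patternCount (hyp : Θ → X → Z) (D : Fin n → X × Y) (S : Finset (Fin n)) : ℕ :=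
  Nat.card (Set.range fun (θ : Θ) (i : S) => hyp θ (D i).1)

/-! The importance weighted learner. -/

/-- What the learner remembers: the hypotheses that are still candidates, and the importance
weighted total loss `∑ (q / p) f(h(x), y)` of each hypothesis over the rounds so far. -/
structure LearnerState (Θ : Type*) where
  /-- the candidate hypotheses -/
  cand : Set Θ
  /-- the importance weighted total loss -/
  total : Θ → ℝ

/-- The probability `p` of querying the label of `x`: the largest loss difference at `x`, over all
labels, of two candidates. -/
def queryProb (hyp : Θ → X → Z) (f : Z → Y → ℝ) (C : Set Θ) (x : X) : ℝ :=
  ⨆ a : C × C × Y, (f (hyp a.1 x) a.2.2 - f (hyp a.2.1 x) a.2.2)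

/-- The query indicator `q`: with `u` uniform on `[0, 1]` it is `1` with probability `p`. -/
def query (hyp : Θ → X → Z) (f : Z → Y → ℝ) (C : Set Θ) (x : X) (u : I) : ℝ :=
  if (u : ℝ) < queryProb hyp f C x then 1 else 0

/-- The slack after `k` rounds, for a bound `N` on the number of prediction patterns. -/
def slack (N δ : ℝ) (k : ℕ) : ℝ :=
  √(8 / (k : ℝ) * Real.log (2 * ((k : ℝ) * ((k : ℝ) + 1)) * N / δ))

/-- One round, after `k` earlier ones. The sample with index `w.1` arrives and its label is queried
according to the coin `w.2`; then those candidates are kept whose importance weighted risk exceeds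
that of no candidate by more than the slack. -/
def learnerStep (hyp : Θ → X → Z) (f : Z → Y → ℝ) (D : Fin n → X × Y) {S : Finset (Fin n)}
    (N δ : ℝ) (k : ℕ) (st : LearnerState Θ) (w : S × I) : LearnerState Θ :=
  let x := (D w.1).1
  let y := (D w.1).2
  let total' : Θ → ℝ := fun θ =>
    st.total θ + query hyp f st.cand x w.2 / queryProb hyp f st.cand x * f (hyp θ x) y
  { cand := {θ ∈ st.cand | ∀ θ' ∈ st.cand,
      total' θ / ((k : ℝ) + 1) ≤ total' θ' / ((k : ℝ) + 1) + slack N δ (k + 1)}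
    total := total' }

/-- The state after `k` rounds, in which the samples and coins `w 0, …, w (k - 1)` were drawn. -/
def learnerRun (hyp : Θ → X → Z) (f : Z → Y → ℝ) (D : Fin n → X × Y) {S : Finset (Fin n)}
    (N δ : ℝ) (w : ℕ → S × I) : ℕ → LearnerState Θ
  | 0 => { cand := Set.univ, total := fun _ => 0 }
  | k + 1 => learnerStep hyp f D N δ k (learnerRun hyp f D N δ w k) (w k)

/-- The law of one round: a uniform sample from the surrogate and an independent uniform coin. -/
def roundLaw (S : Finset (Fin n)) : Measure (S × I) :=
  (uniformOn (Set.univ : Set S)).prod volume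

/-- The label cost of a round with candidates `C`: the expected number of labels that are queried
in it, given the past. -/
def labelCost (hyp : Θ → X → Z) (f : Z → Y → ℝ) (D : Fin n → X × Y) (S : Finset (Fin n))
    (C : Set Θ) : ℝ :=
  ∫ w : S × I, query hyp f C (D w.1).1 w.2 ∂(roundLaw S)

/-- The hypothesis radius around `θ₀` of a set of candidates. -/
def radius (hyp : Θ → X → Z) (f : Z → Y → ℝ) (D : Fin n → X × Y) (S : Finset (Fin n))
    (C : Set Θ) (θ₀ : Θ) : ℝ :=
  ⨆ θ : C, hypDist hyp f D S θ θ₀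

end SurrogateLearning

end

/-!
The risk differences `R(h) - R(h*)` are estimated without bias by the importance weighted loss
differences, and these are bounded by `1` as long as `h` and `h*` are both candidates, because the
query probability `p` dominates the loss differences of candidates. The Azuma–Hoeffding inequality
(`measure_le_adapted_sum_le`), with a union bound over rounds and prediction patterns, shows that
outside an event of probability at most `δ` all estimates are within the slack of the truth
(`measure_deviation_le`). The estimator `weightedGain` is modified where `p` does not dominate, so
that no stopping is needed and it depends on a hypothesis only through its prediction pattern.

The rest is deterministic. By induction `h*` is never discarded (`optimal_mem_cand`), and a
hypothesis that survives a comparison with `h*` has risk at most `R(h*)` plus twice the slack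
(`risk_le_of_mem_cand`). If `r` is the radius of the candidates, they all lie in the ball
`B(h*, r)`, so `ℓ(h, h*)` is at most `r ϑ_r` and the expected number of queries at most `2 r ϑ_r`.
Finally the slope asymmetry replaces the largest loss difference over all labels by the one at the
true label, which gives `ℓ(h, h*) ≤ K_f (R(h) + R(h*))` and so `r ≤ 2 K_f (R(h*) + ε)`
(`ofReal_radius_mul_disagreementAt_le`).
-/

noncomputable section

namespace SurrogateLearning

/-! ### An Azuma–Hoeffding inequality for functions of independent rounds -/

/-- If each factor is a function of the current and the earlier rounds, and its mean over the
current round is at most `c` whatever the past, then the product of `k` factors has mean at most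
`c ^ k`: the current round is independent of the tuple of earlier ones, so it can be integrated out
first. -/
theorem lintegral_prod_le_pow_of_iIndepFun {Ω E : Type*} [MeasurableSpace Ω] [MeasurableSpace E]
    {P : Measure Ω} [IsProbabilityMeasure P] {ν : Measure E} {W : ℕ → Ω → E}
    (hWm : ∀ k, Measurable (W k)) (hWi : iIndepFun W P) (hWl : ∀ k, P.map (W k) = ν)
    (F : ℕ → (ℕ → E) → E → ℝ≥0∞) (hFm : ∀ k, Measurable fun a : (ℕ → E) × E => F k a.1 a.2)
    (hF : ∀ k, DependsOn (F k) (Set.Iio k)) (c : ℝ≥0∞) (hc : ∀ k w, ∫⁻ e, F k w e ∂ν ≤ c)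
    (k : ℕ) :
    ∫⁻ ω, ∏ i ∈ Finset.range k, F i (fun j => W j ω) (W i ω) ∂P ≤ c ^ k := by
  have : IsProbabilityMeasure ν := hWl 0 ▸ Measure.isProbabilityMeasure_map (hWm 0).aemeasurable
  obtain ⟨e₀⟩ : Nonempty E := ν.nonempty_of_neZero
  induction k with
  | zero => simp
  | succ k ih =>
    let past : Ω → (Finset.range k → E) := fun ω i => W i ω
    -- `F k` expects an infinite path: extend the first `k` rounds by a constant
    let ext : (Finset.range k → E) → ℕ → E :=
      fun a i => if h : i ∈ Finset.range k then a ⟨i, h⟩ else e₀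
    have hext : Measurable ext := by
      refine measurable_pi_lambda _ fun i => ?_
      by_cases h : i ∈ Finset.range k
      · simpa only [ext, h, dif_pos] using measurable_pi_apply _
      · simpa only [ext, h, dif_neg, not_false_eq_true] using measurable_const
    have hpast : Measurable past := measurable_pi_lambda _ fun i => hWm i
    have hlt : ∀ ω, ∀ i < k, ext (past ω) i = W i ω := fun ω i hi => by
      simp [ext, past, hi]
    let G : (Finset.range k → E) → ℝ≥0∞ := fun a => ∏ i ∈ Finset.range k, F i (ext a) (ext a i)
    have hGm : Measurable G := Finset.measurable_fun_prod _ fun i _ =>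
      (hFm i).comp (hext.prodMk ((measurable_pi_apply i).comp hext))
    have hG : ∀ ω, G (past ω) = ∏ i ∈ Finset.range k, F i (fun j => W j ω) (W i ω) := fun ω =>
      Finset.prod_congr rfl fun i hi => by
        have hik := Finset.mem_range.1 hi
        rw [hlt ω i hik, hF i fun j hj => hlt ω j (lt_trans hj hik)]
    have hind : IndepFun past (W k) P :=
      (hWi.indepFun_finset (Finset.range k) {k} (by simp) hWm).comp (φ := id)
        (ψ := fun a : (({k} : Finset ℕ) → E) => a ⟨k, by simp⟩) measurable_id
        (measurable_pi_apply _)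
    have hFk : Measurable fun a : (Finset.range k → E) × E => F k (ext a.1) a.2 :=
      (hFm k).comp ((hext.comp measurable_fst).prodMk measurable_snd)
    have hGF : Measurable fun a : (Finset.range k → E) × E => G a.1 * F k (ext a.1) a.2 :=
      (hGm.comp measurable_fst).mul hFk
    have : IsProbabilityMeasure (P.map past) :=
      Measure.isProbabilityMeasure_map hpast.aemeasurable
    calc
      _ = ∫⁻ ω, G (past ω) * F k (ext (past ω)) (W k ω) ∂P := by
        refine lintegral_congr fun ω => ?_
        rw [Finset.prod_range_succ, hG, hF k fun j hj => hlt ω j hj]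
      _ = ∫⁻ a, G a.1 * F k (ext a.1) a.2 ∂((P.map past).prod ν) := by
        rw [← hWl k, ← (indepFun_iff_map_prod_eq_prod_map_map hpast.aemeasurable
          (hWm k).aemeasurable).1 hind, lintegral_map hGF (hpast.prodMk (hWm k))]
      _ = ∫⁻ a, G a * ∫⁻ e, F k (ext a) e ∂ν ∂(P.map past) := by
        rw [lintegral_prod _ hGF.aemeasurable]
        refine lintegral_congr fun a => ?_
        have hFa : Measurable (F k (ext a)) := (hFm k).comp measurable_prodMk_left
        exact lintegral_const_mul (G a) hFa
      _ ≤ ∫⁻ a, G a * c ∂(P.map past) := by gcongr with a; exact hc k _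
      _ = (∫⁻ ω, G (past ω) ∂P) * c := by
        rw [lintegral_mul_const _ hGm, lintegral_map hGm hpast]
      _ ≤ c ^ (k + 1) := by
        rw [pow_succ]; gcongr; simpa only [hG] using ih

/-- The Azuma–Hoeffding inequality for increments in `[-1, 1]` that are a function of independent
rounds, with a conditional mean `m` that does not depend on the past. There is no condition on the
probability space, as no conditional expectations occur. -/
theorem measure_le_adapted_sum_le {Ω E : Type*} [MeasurableSpace Ω] [MeasurableSpace E]
    {P : Measure Ω} [IsProbabilityMeasure P] {ν : Measure E} {W : ℕ → Ω → E}
    (hWm : ∀ k, Measurable (W k)) (hWi : iIndepFun W P) (hWl : ∀ k, P.map (W k) = ν)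
    (ξ : ℕ → (ℕ → E) → E → ℝ) (hξm : ∀ k, Measurable fun a : (ℕ → E) × E => ξ k a.1 a.2)
    (hξ : ∀ k, DependsOn (ξ k) (Set.Iio k)) (hξ1 : ∀ k w e, |ξ k w e| ≤ 1)
    (m : ℝ) (hm : ∀ k w, ∫ e, ξ k w e ∂ν = m) (k : ℕ) (hk : 0 < k) {r : ℝ} (hr : 0 ≤ r) :
    P {ω | r ≤ ∑ i ∈ Finset.range k, (ξ i (fun j => W j ω) (W i ω) - m)} ≤
      ENNReal.ofReal (Real.exp (-(r ^ 2 / (2 * k)))) := by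
  have : IsProbabilityMeasure ν := hWl 0 ▸ Measure.isProbabilityMeasure_map (hWm 0).aemeasurable
  have hk' : (0 : ℝ) < k := by exact_mod_cast hk
  -- the minimizer of the exponent `k s ^ 2 / 2 - s r` of the Chernoff bound
  set s : ℝ := r / k with hs
  have hs0 : 0 ≤ s := by positivity
  let F : ℕ → (ℕ → E) → E → ℝ≥0∞ := fun k w e => ENNReal.ofReal (Real.exp (s * (ξ k w e - m)))
  have hFm : ∀ k, Measurable fun a : (ℕ → E) × E => F k a.1 a.2 := fun k =>
    (Real.measurable_exp.comp (((hξm k).sub_const m).const_mul s)).ennreal_ofReal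
  have hmgf : ∀ k w, ∫⁻ e, F k w e ∂ν ≤ ENNReal.ofReal (Real.exp (s ^ 2 / 2)) := fun k w => by
    have hmeas : Measurable (ξ k w) := (hξm k).comp measurable_prodMk_left
    have hsub := hasSubgaussianMGF_of_mem_Icc (μ := ν) (a := -1) (b := 1) hmeas.aemeasurable
      (Filter.Eventually.of_forall fun e => abs_le.1 (hξ1 k w e))
    rw [hm k w] at hsub
    rw [← ofReal_integral_eq_lintegral_ofReal (hsub.integrable_exp_mul s)
      (Filter.Eventually.of_forall fun _ => (Real.exp_pos _).le)]
    refine ENNReal.ofReal_le_ofReal ((hsub.mgf_le s).trans_eq ?_)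
    norm_num [Real.norm_eq_abs]
  have hprod := lintegral_prod_le_pow_of_iIndepFun hWm hWi hWl F hFm
    (fun k w w' h => by simp only [F, hξ k h]) _ hmgf k
  have hmeas : AEMeasurable (fun ω => ∏ i ∈ Finset.range k, F i (fun j => W j ω) (W i ω)) P :=
    (Finset.measurable_fun_prod _ fun i _ => (hFm i).comp
      ((measurable_pi_lambda _ fun j => hWm j).prodMk (hWm i))).aemeasurable
  have hsub : {ω | r ≤ ∑ i ∈ Finset.range k, (ξ i (fun j => W j ω) (W i ω) - m)} ⊆
      {ω | ENNReal.ofReal (Real.exp (s * r)) ≤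
        ∏ i ∈ Finset.range k, F i (fun j => W j ω) (W i ω)} := fun ω hω => by
    simp only [F, Set.mem_ofPred_eq] at hω ⊢
    rw [← ENNReal.ofReal_prod_of_nonneg fun _ _ => (Real.exp_pos _).le, ← Real.exp_sum,
      ← Finset.mul_sum]
    gcongr
  have hpos : ENNReal.ofReal (Real.exp (s * r)) ≠ 0 := by simp [Real.exp_pos]
  calc
    _ ≤ _ := measure_mono hsub
    _ ≤ _ := meas_ge_le_lintegral_div hmeas hpos ENNReal.ofReal_ne_top
    _ ≤ ENNReal.ofReal (Real.exp (s ^ 2 / 2)) ^ k / ENNReal.ofReal (Real.exp (s * r)) := by gcongr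
    _ = _ := by
      rw [← ENNReal.ofReal_pow (Real.exp_pos _).le, ← ENNReal.ofReal_div_of_pos (Real.exp_pos _),
        ← Real.exp_nat_mul, ← Real.exp_sub]
      congr 2
      rw [hs]; field_simp; ring

/-! ### Query probabilities and the law of a round -/

variable {Θ X Y Z : Type*} {n : ℕ} {hyp : Θ → X → Z} {f : Z → Y → ℝ} {D : Fin n → X × Y}
  {S : Finset (Fin n)}

theorem abs_loss_sub_le_one (hf : ∀ z y, f z y ∈ Set.Icc (0 : ℝ) 1) (z z' : Z) (y y' : Y) :
    |f z y - f z' y'| ≤ 1 :=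
  abs_sub_le_iff.2 ⟨by linarith [(hf z y).2, (hf z' y').1], by linarith [(hf z y).1, (hf z' y').2]⟩

theorem loss_sub_le_queryProb (hf : ∀ z y, f z y ∈ Set.Icc (0 : ℝ) 1) {C : Set Θ} {θ θ' : Θ}
    (hθ : θ ∈ C) (hθ' : θ' ∈ C) (x : X) (y : Y) :
    f (hyp θ x) y - f (hyp θ' x) y ≤ queryProb hyp f C x :=
  le_ciSup (f := fun a : C × C × Y => f (hyp a.1 x) a.2.2 - f (hyp a.2.1 x) a.2.2)
    ⟨1, by rintro _ ⟨a, rfl⟩; exact (abs_le.1 (abs_loss_sub_le_one hf _ _ _ _)).2⟩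
    (⟨θ, hθ⟩, ⟨θ', hθ'⟩, y)

theorem abs_loss_sub_le_queryProb (hf : ∀ z y, f z y ∈ Set.Icc (0 : ℝ) 1) {C : Set Θ} {θ θ' : Θ}
    (hθ : θ ∈ C) (hθ' : θ' ∈ C) (x : X) (y : Y) :
    |f (hyp θ x) y - f (hyp θ' x) y| ≤ queryProb hyp f C x :=
  abs_sub_le_iff.2 ⟨loss_sub_le_queryProb hf hθ hθ' x y, loss_sub_le_queryProb hf hθ' hθ x y⟩

theorem queryProb_mem_Icc (hf : ∀ z y, f z y ∈ Set.Icc (0 : ℝ) 1) (C : Set Θ) (x : X) :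
    queryProb hyp f C x ∈ Set.Icc (0 : ℝ) 1 := by
  refine ⟨?_, Real.iSup_le (fun a => (abs_le.1 (abs_loss_sub_le_one hf _ _ _ _)).2) zero_le_one⟩
  rcases isEmpty_or_nonempty (C × C × Y) with h | ⟨⟨θ, _, y⟩⟩
  · rw [queryProb, Real.iSup_of_isEmpty]
  · simpa using loss_sub_le_queryProb (hyp := hyp) hf θ.2 θ.2 x y

theorem query_eq_zero_or_one (C : Set Θ) (x : X) (u : I) :
    query hyp f C x u = 0 ∨ query hyp f C x u = 1 := by
  unfold query; split_ifs <;> simp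

/-- The query indicator has mean `p`, as `p` lies in `[0, 1]`. -/
theorem integral_query (hf : ∀ z y, f z y ∈ Set.Icc (0 : ℝ) 1) (C : Set Θ) (x : X) :
    ∫ u, query hyp f C x u = queryProb hyp f C x := by
  have hp := queryProb_mem_Icc (hyp := hyp) hf C x
  have h : (fun u : I => query hyp f C x u) =
      (Set.Iio (⟨queryProb hyp f C x, hp⟩ : I)).indicator fun _ => (1 : ℝ) := by
    ext u
    simp only [query, Set.indicator_apply, Set.mem_Iio, ← Subtype.coe_lt_coe]
  rw [h, integral_indicator_const _ measurableSet_Iio, Measure.real, unitInterval.volume_Iio,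
    ENNReal.toReal_ofReal hp.1, smul_eq_mul, mul_one]

theorem isProbabilityMeasure_roundLaw (hS : S.Nonempty) : IsProbabilityMeasure (roundLaw S) := by
  have : Nonempty S := hS.to_subtype
  have := isProbabilityMeasure_uniformOn (Set.finite_univ (α := S)) Set.univ_nonempty
  unfold roundLaw; infer_instance

theorem integral_roundLaw (hS : S.Nonempty) {F : S × I → ℝ} (hF : Integrable F (roundLaw S)) :
    ∫ w, F w ∂(roundLaw S) = (∑ i : S, ∫ u, F (i, u)) / S.card := by
  have : Nonempty S := hS.to_subtype
  have := isProbabilityMeasure_uniformOn (Set.finite_univ (α := S)) Set.univ_nonempty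
  have h1 : ∀ i : S, (uniformOn (Set.univ : Set S)).real {i} = (S.card : ℝ)⁻¹ := fun i => by
    simp [Measure.real, uniformOn_univ]
  unfold roundLaw at hF ⊢
  rw [integral_prod _ hF, integral_fintype .of_finite]
  simp only [h1, smul_eq_mul, ← Finset.mul_sum]
  rw [inv_mul_eq_div]

/-! ### Measurability of the learner -/

section Measurability

variable [Finite Θ]

theorem measurable_queryProb :
    Measurable fun a : Set Θ × (S × I) => queryProb hyp f a.1 (D a.2.1).1 :=
  (measurable_of_countable fun a : Set Θ × S => queryProb hyp f a.1 (D a.2).1).comp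
    (measurable_fst.prodMk (measurable_fst.comp measurable_snd))

theorem measurable_query :
    Measurable fun a : Set Θ × (S × I) => query hyp f a.1 (D a.2.1).1 a.2.2 :=
  Measurable.ite (measurableSet_lt
    (measurable_subtype_coe.comp (measurable_snd.comp measurable_snd)) measurable_queryProb)
    measurable_const measurable_const

theorem measurable_learnerRun (N δ : ℝ) (k : ℕ) :
    (Measurable fun w : ℕ → S × I => (learnerRun hyp f D N δ w k).cand) ∧
      ∀ θ, Measurable fun w : ℕ → S × I => (learnerRun hyp f D N δ w k).total θ := by
  induction k with
  | zero => exact ⟨measurable_const, fun θ => measurable_const⟩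
  | succ k ih =>
    have hpair := ih.1.prodMk (measurable_pi_apply (X := fun _ : ℕ => S × I) k)
    have htot : ∀ θ, Measurable
        fun w : ℕ → S × I => (learnerRun hyp f D N δ w (k + 1)).total θ := fun θ =>
      (ih.2 θ).add (((measurable_query.comp hpair).div (measurable_queryProb.comp hpair)).mul
        ((measurable_of_countable fun i : S => f (hyp θ (D i).1) (D i).2).comp
          (measurable_fst.comp (measurable_pi_apply k))))
    refine ⟨measurable_set_iff.2 fun θ => ?_, htot⟩
    exact (measurable_set_iff.1 ih.1 θ).and <| Measurable.forall fun θ' =>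
      (measurable_set_iff.1 ih.1 θ').imp <| measurableSet_setOfPred.1 <|
        measurableSet_le ((htot θ).div_const _) (((htot θ').div_const _).add_const _)

end Measurability

theorem dependsOn_learnerRun (N δ : ℝ) (k : ℕ) :
    DependsOn (fun w : ℕ → S × I => learnerRun hyp f D N δ w k) (Set.Iio k) := by
  intro w w' h
  induction k with
  | zero => rfl
  | succ k ih =>
    simp only [learnerRun]
    have := ih fun i hi => h i (Set.mem_Iio.2 (Nat.lt_succ_of_lt hi))
    dsimp only at this
    rw [this, h k (Set.mem_Iio.2 k.lt_succ_self)]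

/-! ### Unbiased estimates of risk differences and their deviations -/

/-- The importance weighted estimate `(q / p) g(i)` of the average of `g` over the surrogate. Where
`|g(i)|` exceeds `p`, which does not happen for the loss difference of two candidates, it is
replaced by `g(i)` itself. So it is unbiased and bounded by `1` for every `g` with `|g| ≤ 1`,
whatever the candidates are. -/
def weightedGain (hyp : Θ → X → Z) (f : Z → Y → ℝ) (D : Fin n → X × Y) (g : S → ℝ) (C : Set Θ)
    (w : S × I) : ℝ :=
  if |g w.1| ≤ queryProb hyp f C (D w.1).1 then
    query hyp f C (D w.1).1 w.2 / queryProb hyp f C (D w.1).1 * g w.1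
  else g w.1

theorem abs_weightedGain_le_one {g : S → ℝ} (hg : ∀ i, |g i| ≤ 1) (C : Set Θ) (w : S × I) :
    |weightedGain hyp f D g C w| ≤ 1 := by
  unfold weightedGain
  split_ifs with h
  · rcases query_eq_zero_or_one (hyp := hyp) (f := f) C (D w.1).1 w.2 with h0 | h0 <;> rw [h0]
    · simp
    · have hp := (abs_nonneg _).trans h
      rw [abs_mul, abs_div, abs_one, abs_of_nonneg hp, one_div_mul_eq_div]
      exact div_le_one_of_le₀ h hp
  · exact hg _

theorem measurable_weightedGain [Finite Θ] (g : S → ℝ) :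
    Measurable fun a : Set Θ × (S × I) => weightedGain hyp f D g a.1 a.2 := by
  have hg : Measurable fun a : Set Θ × (S × I) => g a.2.1 :=
    (measurable_of_countable g).comp (measurable_fst.comp measurable_snd)
  refine Measurable.ite (measurableSet_le ?_ measurable_queryProb)
    ((measurable_query.div measurable_queryProb).mul hg) hg
  exact continuous_abs.measurable.comp hg

theorem integral_weightedGain [Finite Θ] (hf : ∀ z y, f z y ∈ Set.Icc (0 : ℝ) 1)
    (hS : S.Nonempty) {g : S → ℝ} (hg : ∀ i, |g i| ≤ 1) (C : Set Θ) :
    ∫ w, weightedGain hyp f D g C w ∂(roundLaw S) = (∑ i, g i) / S.card := by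
  have := isProbabilityMeasure_roundLaw hS
  have hm : Measurable (weightedGain hyp f D g C) :=
    (measurable_weightedGain g).comp measurable_prodMk_left
  rw [integral_roundLaw hS (.of_mem_Icc (-1) 1 hm.aemeasurable
    (Filter.Eventually.of_forall fun w => abs_le.1 (abs_weightedGain_le_one hg C w)))]
  congr 1
  refine Finset.sum_congr rfl fun i _ => ?_
  by_cases h : |g i| ≤ queryProb hyp f C (D i).1
  · simp only [weightedGain, h, if_true]
    rw [integral_mul_const, integral_div, integral_query hf]
    rcases eq_or_ne (queryProb hyp f C (D i).1) 0 with h0 | h0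
    -- for `p = 0` the junk value `q / p = 0` is harmless, as then `g i = 0`
    · have : g i = 0 := abs_nonpos_iff.1 (h0 ▸ h)
      simp [this]
    · rw [div_self h0, one_mul]
  · simp [weightedGain, h]

theorem one_lt_slack_arg {N δ : ℝ} (hN : 1 ≤ N) (hδ : 0 < δ) (hδ1 : δ ≤ 1) (k : ℕ) :
    1 < 2 * (((k + 1 : ℕ) : ℝ) * (((k + 1 : ℕ) : ℝ) + 1)) * N / δ := by
  rw [one_lt_div hδ]
  have : (1 : ℝ) ≤ ((k + 1 : ℕ) : ℝ) * (((k + 1 : ℕ) : ℝ) + 1) := by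
    push_cast; nlinarith [k.cast_nonneg (α := ℝ)]
  nlinarith

theorem slack_pos {N δ : ℝ} (hN : 1 ≤ N) (hδ : 0 < δ) (hδ1 : δ ≤ 1) (k : ℕ) :
    0 < slack N δ (k + 1) :=
  Real.sqrt_pos.2 (mul_pos (by positivity) (Real.log_pos (one_lt_slack_arg hN hδ hδ1 k)))

/-- The slack makes one tail of a sum over `k + 1` rounds small enough for the union bound over
both tails, `N` patterns and all `k`. -/
theorem exp_neg_slack_le {N δ : ℝ} (hN : 1 ≤ N) (hδ : 0 < δ) (hδ1 : δ ≤ 1) (k : ℕ) :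
    Real.exp (-((((k + 1 : ℕ) : ℝ) * slack N δ (k + 1)) ^ 2 / (2 * ((k + 1 : ℕ) : ℝ)))) ≤
      δ / (2 * (((k : ℝ) + 1) * ((k : ℝ) + 2)) * N) := by
  have hN0 : 0 < N := by linarith
  set A : ℝ := 2 * (((k + 1 : ℕ) : ℝ) * (((k + 1 : ℕ) : ℝ) + 1)) * N / δ with hA
  have hA1 : 1 ≤ A := (one_lt_slack_arg hN hδ hδ1 k).le
  have hlog := Real.log_nonneg hA1
  have hk : (0 : ℝ) < ((k + 1 : ℕ) : ℝ) := by positivity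
  have hsq : slack N δ (k + 1) ^ 2 = 8 / ((k + 1 : ℕ) : ℝ) * Real.log A :=
    Real.sq_sqrt (mul_nonneg (by positivity) hlog)
  calc
    _ = Real.exp (-(4 * Real.log A)) := by rw [mul_pow, hsq]; congr 2; field_simp; ring
    -- a factor `4` in the exponent is given away here
    _ ≤ Real.exp (-Real.log A) := by gcongr; linarith
    _ = _ := by
      rw [Real.exp_neg, Real.exp_log (by linarith), hA, inv_div]; push_cast; ring_nf

theorem one_le_patternCount [Finite Θ] [Nonempty Θ] : 1 ≤ patternCount hyp D S := by
  have := Set.finite_range fun (θ : Θ) (i : S) => hyp θ (D i).1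
  have := this.to_subtype
  exact Nat.card_pos

theorem risk_sub_risk (θ θ' : Θ) : risk hyp f D S θ - risk hyp f D S θ' =
    (∑ i : S, (f (hyp θ (D i).1) (D i).2 - f (hyp θ' (D i).1) (D i).2)) / S.card := by
  rw [risk, risk, ← sub_div, ← Finset.sum_sub_distrib, ← Finset.sum_coe_sort S]

theorem sum_one_div_mul_succ_eq (m : ℕ) :
    ∑ k ∈ Finset.range m, 1 / (((k : ℝ) + 1) * ((k : ℝ) + 2)) = 1 - 1 / ((m : ℝ) + 1) := by
  induction m with
  | zero => simp
  | succ m ih => rw [Finset.sum_range_succ, ih]; push_cast; field_simp; ring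

/-- The loss difference of the hypotheses `θ` and `θ₀` on the samples of the surrogate. -/
def lossDiff (hyp : Θ → X → Z) (f : Z → Y → ℝ) (D : Fin n → X × Y) (θ θ₀ : Θ) (j : S) : ℝ :=
  f (hyp θ (D j).1) (D j).2 - f (hyp θ₀ (D j).1) (D j).2

/-- The deviation, after `k` rounds with samples and coins `w`, of the sum of the estimates
`weightedGain` of the risk difference of `θ` and `θ₀` from its mean. -/
def deviation (hyp : Θ → X → Z) (f : Z → Y → ℝ) (D : Fin n → X × Y) (N δ : ℝ) (θ θ₀ : Θ)
    (w : ℕ → S × I) (k : ℕ) : ℝ :=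
  ∑ i ∈ Finset.range k, (weightedGain hyp f D (lossDiff hyp f D θ θ₀)
    (learnerRun hyp f D N δ w i).cand (w i) - (risk hyp f D S θ - risk hyp f D S θ₀))

/-- With probability at least `1 - δ`, the deviations of all hypotheses, averaged over the rounds,
stay below the slack in all rounds. The deviation of `θ` depends on `θ` only through its
prediction pattern, so the union bound is over at most `N` patterns; the rounds
contribute `∑ δ / ((k + 1) (k + 2)) = δ`. -/
theorem measure_deviation_le {Ω : Type*} [Finite Θ] (hf : ∀ z y, f z y ∈ Set.Icc (0 : ℝ) 1)
    (hS : S.Nonempty) (θ₀ : Θ) {N δ : ℝ} (hN : (patternCount hyp D S : ℝ) ≤ N)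
    (hδ : 0 < δ) (hδ1 : δ ≤ 1) [MeasurableSpace Ω] {P : Measure Ω} [IsProbabilityMeasure P]
    {W : ℕ → Ω → S × I} (hWm : ∀ k, Measurable (W k)) (hWi : iIndepFun W P)
    (hWl : ∀ k, P.map (W k) = roundLaw S) :
    P {ω | ∃ (k : ℕ) (θ : Θ), ((k + 1 : ℕ) : ℝ) * slack N δ (k + 1) ≤
      |deviation hyp f D N δ θ θ₀ (fun j => W j ω) (k + 1)|} ≤ ENNReal.ofReal δ := by
  have : Nonempty Θ := ⟨θ₀⟩
  have hN1 : 1 ≤ N := le_trans (by exact_mod_cast one_le_patternCount) hN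
  let pat : Set (S → Z) := Set.range fun (θ : Θ) (i : S) => hyp θ (D i).1
  have := (Set.finite_range fun (θ : Θ) (i : S) => hyp θ (D i).1).to_subtype
  have := Fintype.ofFinite pat
  let g : (S → Z) → S → ℝ := fun π j => f (π j) (D j).2 - f (hyp θ₀ (D j).1) (D j).2
  have hg : ∀ π j, |g π j| ≤ 1 := fun π j => abs_loss_sub_le_one hf _ _ _ _
  let ξ : (S → Z) → ℕ → (ℕ → S × I) → S × I → ℝ := fun π i w =>
    weightedGain hyp f D (g π) (learnerRun hyp f D N δ w i).cand
  have hξm : ∀ π i, Measurable fun a : (ℕ → S × I) × (S × I) => ξ π i a.1 a.2 := fun π i =>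
    (measurable_weightedGain (g π)).comp
      (((measurable_learnerRun N δ i).1.comp measurable_fst).prodMk measurable_snd)
  have hξd : ∀ π i, DependsOn (ξ π i) (Set.Iio i) := fun π i w w' h => by
    have := dependsOn_learnerRun (hyp := hyp) (f := f) (D := D) N δ i h
    dsimp only at this
    simp only [ξ, this]
  have hξ1 : ∀ π i w e, |ξ π i w e| ≤ 1 := fun π i w e => abs_weightedGain_le_one (hg π) _ _
  have hξi : ∀ π i w, ∫ e, ξ π i w e ∂(roundLaw S) = (∑ j, g π j) / S.card := fun π i w =>
    integral_weightedGain hf hS (hg π) _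
  let bad : ℕ → (S → Z) → Set Ω := fun k π => {ω | ((k + 1 : ℕ) : ℝ) * slack N δ (k + 1) ≤
    |∑ i ∈ Finset.range (k + 1), (ξ π i (fun j => W j ω) (W i ω) - (∑ j, g π j) / S.card)|}
  have hbad : ∀ k π, P (bad k π) ≤
      ENNReal.ofReal (δ / (((k : ℝ) + 1) * ((k : ℝ) + 2)) / N) := fun k π => by
    have hr : 0 ≤ ((k + 1 : ℕ) : ℝ) * slack N δ (k + 1) :=
      mul_nonneg (Nat.cast_nonneg _) (Real.sqrt_nonneg _)
    have h1 := measure_le_adapted_sum_le hWm hWi hWl (ξ π) (hξm π) (hξd π) (hξ1 π) _ (hξi π)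
      (k + 1) k.succ_pos hr
    have h2 := measure_le_adapted_sum_le hWm hWi hWl (fun i w e => -ξ π i w e)
      (fun i => (hξm π i).neg) (fun i w w' h => by simp only [hξd π i h])
      (fun i w e => by rw [abs_neg]; exact hξ1 π i w e) (-((∑ j, g π j) / S.card))
      (fun i w => by rw [integral_neg, hξi]) (k + 1) k.succ_pos hr
    refine ((measure_mono fun ω hω => ?_).trans
      ((measure_union_le _ _).trans (add_le_add h1 h2))).trans ?_
    · rcases le_abs.1 (Set.mem_ofPred_eq ▸ hω : _ ≤ |_|) with h | h
      · exact Or.inl h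
      · refine Or.inr ?_
        rw [← Finset.sum_neg_distrib] at h
        exact h.trans_eq (Finset.sum_congr rfl fun i _ => by ring)
    rw [← ENNReal.ofReal_add (Real.exp_pos _).le (Real.exp_pos _).le]
    refine ENNReal.ofReal_le_ofReal
      ((add_le_add (exp_neg_slack_le hN1 hδ hδ1 k) (exp_neg_slack_le hN1 hδ hδ1 k)).trans_eq ?_)
    have : N ≠ 0 := by linarith
    field_simp
    norm_num
  have hk : ∀ k : ℕ, ∑ π : pat, P (bad k π) ≤
      ENNReal.ofReal (δ * (1 / (((k : ℝ) + 1) * ((k : ℝ) + 2)))) := fun k => by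
    refine (Finset.sum_le_sum fun (π : pat) _ => hbad k π).trans ?_
    rw [Finset.sum_const, Finset.card_univ, ← Nat.card_eq_fintype_card, ← ENNReal.ofReal_nsmul]
    refine ENNReal.ofReal_le_ofReal ?_
    rw [nsmul_eq_mul, mul_one_div, mul_div_left_comm]
    refine mul_le_of_le_one_right (by positivity) (div_le_one_of_le₀ hN (by linarith))
  calc
    _ ≤ P (⋃ k : ℕ, ⋃ π : pat, bad k π) := by
      refine measure_mono ?_
      rintro ω ⟨k, θ, h⟩
      refine Set.mem_iUnion₂.2 ⟨k, ⟨_, θ, rfl⟩, ?_⟩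
      rw [deviation, risk_sub_risk] at h
      exact h
    _ ≤ ∑' k : ℕ, ∑ π : pat, P (bad k π) :=
      (measure_iUnion_le _).trans (ENNReal.tsum_le_tsum fun k => measure_iUnion_fintype_le _ _)
    _ ≤ ∑' k : ℕ, ENNReal.ofReal (δ * (1 / (((k : ℝ) + 1) * ((k : ℝ) + 2)))) :=
      ENNReal.tsum_le_tsum hk
    _ ≤ ENNReal.ofReal δ := by
      refine ENNReal.tsum_le_of_sum_range_le fun m => ?_
      rw [← ENNReal.ofReal_sum_of_nonneg fun k _ => by positivity, ← Finset.mul_sum,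
        sum_one_div_mul_succ_eq]
      refine ENNReal.ofReal_le_ofReal (mul_le_of_le_one_right hδ.le ?_)
      have : (0 : ℝ) ≤ 1 / ((m : ℝ) + 1) := by positivity
      linarith

/-! ### Survival of the optimal hypothesis -/

section Survival

variable {N δ : ℝ} {w : ℕ → S × I}

theorem learnerRun_cand_antitone : Antitone fun k => (learnerRun hyp f D N δ w k).cand :=
  antitone_nat_of_succ_le fun _ _ hθ => hθ.1

/-- While both hypotheses are candidates, `weightedGain` is what the learner adds to the difference
of their total losses. -/
theorem total_sub_total (hf : ∀ z y, f z y ∈ Set.Icc (0 : ℝ) 1) {θ θ₀ : Θ} (k : ℕ)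
    (h : ∀ i < k, θ ∈ (learnerRun hyp f D N δ w i).cand ∧
      θ₀ ∈ (learnerRun hyp f D N δ w i).cand) :
    (learnerRun hyp f D N δ w k).total θ - (learnerRun hyp f D N δ w k).total θ₀ =
      ∑ i ∈ Finset.range k, weightedGain hyp f D (lossDiff hyp f D θ θ₀)
        (learnerRun hyp f D N δ w i).cand (w i) := by
  induction k with
  | zero => simp [learnerRun]
  | succ k ih =>
    obtain ⟨hθ, hθ₀⟩ := h k k.lt_succ_self
    rw [Finset.sum_range_succ, ← ih fun i hi => h i (Nat.lt_succ_of_lt hi), weightedGain,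
      lossDiff, if_pos (abs_loss_sub_le_queryProb hf hθ hθ₀ _ _)]
    simp only [learnerRun, learnerStep]
    ring

theorem abs_total_sub_lt (hf : ∀ z y, f z y ∈ Set.Icc (0 : ℝ) 1) {θ θ₀ : Θ} {k : ℕ} {c : ℝ}
    (h : |deviation hyp f D N δ θ θ₀ w (k + 1)| < c)
    (hθ : θ ∈ (learnerRun hyp f D N δ w k).cand) (hθ₀ : θ₀ ∈ (learnerRun hyp f D N δ w k).cand) :
    |(learnerRun hyp f D N δ w (k + 1)).total θ - (learnerRun hyp f D N δ w (k + 1)).total θ₀ -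
      ((k : ℝ) + 1) * (risk hyp f D S θ - risk hyp f D S θ₀)| < c := by
  rw [deviation, Finset.sum_sub_distrib, ← total_sub_total hf (k + 1) fun i hi =>
    ⟨learnerRun_cand_antitone (Nat.lt_succ_iff.1 hi) hθ,
      learnerRun_cand_antitone (Nat.lt_succ_iff.1 hi) hθ₀⟩] at h
  simpa only [Finset.sum_const, Finset.card_range, nsmul_eq_mul, Nat.cast_add, Nat.cast_one] using h

theorem optimal_mem_cand {θ₀ : Θ} (hf : ∀ z y, f z y ∈ Set.Icc (0 : ℝ) 1)
    (hgood : ∀ (k : ℕ) (θ : Θ),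
      |deviation hyp f D N δ θ θ₀ w (k + 1)| < ((k + 1 : ℕ) : ℝ) * slack N δ (k + 1))
    (h₀ : ∀ θ, risk hyp f D S θ₀ ≤ risk hyp f D S θ) (k : ℕ) :
    θ₀ ∈ (learnerRun hyp f D N δ w k).cand := by
  induction k with
  | zero => exact Set.mem_univ _
  | succ k ih =>
    refine ⟨ih, fun θ hθ => ?_⟩
    have hk : (0 : ℝ) < (k : ℝ) + 1 := by positivity
    have h := (abs_lt.1 (abs_total_sub_lt hf (hgood k θ) hθ ih)).1
    have hR := mul_nonneg hk.le (sub_nonneg.2 (h₀ θ))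
    change (learnerRun hyp f D N δ w (k + 1)).total θ₀ / _ ≤
      (learnerRun hyp f D N δ w (k + 1)).total θ / _ + _
    rw [div_add' _ _ _ hk.ne']
    gcongr
    push_cast at h
    linarith

theorem risk_le_of_mem_cand {θ₀ : Θ} (hf : ∀ z y, f z y ∈ Set.Icc (0 : ℝ) 1)
    (hgood : ∀ (k : ℕ) (θ : Θ),
      |deviation hyp f D N δ θ θ₀ w (k + 1)| < ((k + 1 : ℕ) : ℝ) * slack N δ (k + 1))
    (h₀ : ∀ θ, risk hyp f D S θ₀ ≤ risk hyp f D S θ) (k : ℕ)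
    {θ : Θ} (hθ : θ ∈ (learnerRun hyp f D N δ w (k + 1)).cand) :
    risk hyp f D S θ ≤ risk hyp f D S θ₀ + 2 * slack N δ (k + 1) := by
  have hk : (0 : ℝ) < (k : ℝ) + 1 := by positivity
  have hmem := optimal_mem_cand hf hgood h₀ k
  have h := (abs_lt.1 (abs_total_sub_lt hf (hgood k θ) hθ.1 hmem)).1
  have hkeep : (learnerRun hyp f D N δ w (k + 1)).total θ / ((k : ℝ) + 1) ≤
    (learnerRun hyp f D N δ w (k + 1)).total θ₀ / ((k : ℝ) + 1) + slack N δ (k + 1) :=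
      hθ.2 θ₀ hmem
  rw [div_add' _ _ _ hk.ne', div_le_div_iff_of_pos_right hk] at hkeep
  push_cast at h
  refine le_of_mul_le_mul_left ?_ hk
  linarith

end Survival

/-! ### Hypothesis radius, label cost and slope asymmetry -/

theorem lossGap_nonneg (z z' : Z) : 0 ≤ lossGap f z z' := Real.iSup_nonneg fun _ => abs_nonneg _

theorem abs_sub_le_lossGap (hf : ∀ z y, f z y ∈ Set.Icc (0 : ℝ) 1) (z z' : Z) (y : Y) :
    |f z y - f z' y| ≤ lossGap f z z' :=
  le_ciSup (f := fun y => |f z y - f z' y|)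
    ⟨1, by rintro _ ⟨y, rfl⟩; exact abs_loss_sub_le_one hf _ _ _ _⟩ y

theorem hypDist_nonneg (θ θ' : Θ) : 0 ≤ hypDist hyp f D S θ θ' :=
  div_nonneg (Finset.sum_nonneg fun _ _ => lossGap_nonneg _ _) (Nat.cast_nonneg _)

theorem radius_nonneg (C : Set Θ) (θ₀ : Θ) : 0 ≤ radius hyp f D S C θ₀ :=
  Real.iSup_nonneg fun _ => hypDist_nonneg _ _

theorem risk_nonneg (hf : ∀ z y, f z y ∈ Set.Icc (0 : ℝ) 1) (θ : Θ) : 0 ≤ risk hyp f D S θ :=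
  div_nonneg (Finset.sum_nonneg fun _ _ => (hf _ _).1) (Nat.cast_nonneg _)

theorem disagreementAt_nonneg (θ₀ : Θ) {r : ℝ} (hr : 0 ≤ r) :
    0 ≤ disagreementAt hyp f D S θ₀ r :=
  div_nonneg (Finset.sum_nonneg fun _ _ => Real.iSup_nonneg fun _ =>
    div_nonneg (lossGap_nonneg _ _) hr) (Nat.cast_nonneg _)

theorem hypDist_le_radius [Finite Θ] {C : Set Θ} (θ₀ : Θ) {θ : Θ} (hθ : θ ∈ C) :
    hypDist hyp f D S θ θ₀ ≤ radius hyp f D S C θ₀ :=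
  le_ciSup (f := fun θ : C => hypDist hyp f D S θ θ₀) (Set.finite_range _).bddAbove ⟨θ, hθ⟩

/-- For `r = 0` the supremum is of quotients by zero, but then the candidates have the
same losses as `θ₀` on the surrogate, and the left-hand side vanishes as well. -/
theorem lossGap_le_radius_mul [Finite Θ] {C : Set Θ} (θ₀ : Θ) {θ : Θ} (hθ : θ ∈ C) {i : Fin n}
    (hi : i ∈ S) :
    lossGap f (hyp θ (D i).1) (hyp θ₀ (D i).1) ≤ radius hyp f D S C θ₀ *
      ⨆ θ : hypBall hyp f D S θ₀ (radius hyp f D S C θ₀),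
        lossGap f (hyp θ (D i).1) (hyp θ₀ (D i).1) / radius hyp f D S C θ₀ := by
  have hdist := hypDist_le_radius (hyp := hyp) (f := f) (D := D) (S := S) θ₀ hθ
  rcases (radius_nonneg (hyp := hyp) (f := f) (D := D) (S := S) C θ₀).eq_or_lt' with hr | hr
  · have hcard : (0 : ℝ) < S.card := Nat.cast_pos.2 (Finset.card_pos.2 ⟨i, hi⟩)
    rw [hr, hypDist, div_le_iff₀ hcard, zero_mul] at hdist
    rw [hr, zero_mul]
    exact (Finset.single_le_sum (f := fun i => lossGap f (hyp θ (D i).1) (hyp θ₀ (D i).1))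
      (fun _ _ => lossGap_nonneg _ _) hi).trans hdist
  · rw [← div_le_iff₀' hr]
    exact le_ciSup (f := fun θ : hypBall hyp f D S θ₀ (radius hyp f D S C θ₀) =>
      lossGap f (hyp θ (D i).1) (hyp θ₀ (D i).1) / radius hyp f D S C θ₀)
      (Set.finite_range _).bddAbove ⟨θ, hdist⟩

theorem hypDist_le_radius_mul_disagreementAt [Finite Θ] {C : Set Θ} (θ₀ : Θ) {θ : Θ}
    (hθ : θ ∈ C) :
    hypDist hyp f D S θ θ₀ ≤ radius hyp f D S C θ₀ *
      disagreementAt hyp f D S θ₀ (radius hyp f D S C θ₀) := by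
  rw [hypDist, disagreementAt, ← mul_div_assoc, Finset.mul_sum]
  gcongr with i hi
  exact lossGap_le_radius_mul θ₀ hθ hi

theorem labelCost_eq [Finite Θ] (hf : ∀ z y, f z y ∈ Set.Icc (0 : ℝ) 1) (hS : S.Nonempty)
    (C : Set Θ) :
    labelCost hyp f D S C = (∑ i ∈ S, queryProb hyp f C (D i).1) / S.card := by
  have := isProbabilityMeasure_roundLaw hS
  have hm : Measurable fun w : S × I => query hyp f C (D w.1).1 w.2 :=
    measurable_query.comp measurable_prodMk_left
  have hint : Integrable (fun w : S × I => query hyp f C (D w.1).1 w.2) (roundLaw S) :=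
    .of_mem_Icc 0 1 hm.aemeasurable (Filter.Eventually.of_forall fun w => by
      rcases query_eq_zero_or_one (hyp := hyp) (f := f) C (D w.1).1 w.2 with h | h <;> simp [h])
  rw [labelCost, integral_roundLaw hS hint]
  simp only [integral_query hf]
  rw [Finset.sum_coe_sort S fun i => queryProb hyp f C (D i).1]

/-- Two candidates differ from each other at most by the sum of their distances from `θ₀`. -/
theorem labelCost_le_radius_mul_disagreementAt [Finite Θ]
    (hf : ∀ z y, f z y ∈ Set.Icc (0 : ℝ) 1) (hS : S.Nonempty) (C : Set Θ) (θ₀ : Θ) :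
    labelCost hyp f D S C ≤ 2 * (radius hyp f D S C θ₀ *
      disagreementAt hyp f D S θ₀ (radius hyp f D S C θ₀)) := by
  have hr := radius_nonneg (hyp := hyp) (f := f) (D := D) (S := S) C θ₀
  rw [labelCost_eq hf hS, disagreementAt, ← mul_div_assoc, ← mul_div_assoc, Finset.mul_sum,
    Finset.mul_sum]
  gcongr with i hi
  refine Real.iSup_le (fun a => ?_) (mul_nonneg zero_le_two (mul_nonneg hr
    (Real.iSup_nonneg fun _ => div_nonneg (lossGap_nonneg _ _) hr)))
  have h1 := (le_abs_self _).trans ((abs_sub_le_lossGap hf _ _ a.2.2).trans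
    (lossGap_le_radius_mul (hyp := hyp) (f := f) (D := D) θ₀ a.1.2 hi))
  have h2 := (neg_le_abs _).trans ((abs_sub_le_lossGap hf _ _ a.2.2).trans
    (lossGap_le_radius_mul (hyp := hyp) (f := f) (D := D) θ₀ a.2.1.2 hi))
  linarith

/-- A finite slope asymmetry bounds the largest loss difference over all labels by the one at any
label, in particular at the true one. -/
theorem lossGap_le_slopeAsymmetry_mul (hK : slopeAsymmetry hyp f D S ≠ ∞) (θ θ' : Θ) {i : Fin n}
    (hi : i ∈ S) (y : Y) :
    lossGap f (hyp θ (D i).1) (hyp θ' (D i).1) ≤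
      (slopeAsymmetry hyp f D S).toReal * |f (hyp θ (D i).1) y - f (hyp θ' (D i).1) y| := by
  have hinf : (⨅ y, ENNReal.ofReal |f (hyp θ (D i).1) y - f (hyp θ' (D i).1) y|) ≤
      ENNReal.ofReal |f (hyp θ (D i).1) y - f (hyp θ' (D i).1) y| := iInf_le _ y
  have hquot : (⨆ y, ENNReal.ofReal |f (hyp θ (D i).1) y - f (hyp θ' (D i).1) y|) /
      (⨅ y, ENNReal.ofReal |f (hyp θ (D i).1) y - f (hyp θ' (D i).1) y|) ≤
      slopeAsymmetry hyp f D S :=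
    le_iSup_of_le θ <| le_iSup_of_le θ' <| le_iSup₂_of_le i hi <| le_iSup₂_of_le i hi le_rfl
  rw [ENNReal.div_le_iff_le_mul (Or.inr hK)
    (Or.inl (hinf.trans_lt ENNReal.ofReal_lt_top).ne)] at hquot
  have hnn : 0 ≤ (slopeAsymmetry hyp f D S).toReal *
      |f (hyp θ (D i).1) y - f (hyp θ' (D i).1) y| := by positivity
  refine Real.iSup_le (fun y' => ?_) hnn
  rw [← ENNReal.ofReal_le_ofReal_iff hnn, ENNReal.ofReal_mul ENNReal.toReal_nonneg,
    ENNReal.ofReal_toReal hK]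
  exact (le_iSup (fun y => ENNReal.ofReal |f (hyp θ (D i).1) y - f (hyp θ' (D i).1) y|) y').trans
    (hquot.trans (mul_le_mul_right hinf _))

theorem hypDist_le_slopeAsymmetry_mul (hf : ∀ z y, f z y ∈ Set.Icc (0 : ℝ) 1)
    (hK : slopeAsymmetry hyp f D S ≠ ∞) (θ θ' : Θ) :
    hypDist hyp f D S θ θ' ≤
      (slopeAsymmetry hyp f D S).toReal * (risk hyp f D S θ + risk hyp f D S θ') := by
  rw [hypDist, risk, risk, ← add_div, ← mul_div_assoc, ← Finset.sum_add_distrib, Finset.mul_sum]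
  gcongr with i hi
  refine (lossGap_le_slopeAsymmetry_mul hK θ θ' hi (D i).2).trans ?_
  gcongr
  rw [abs_sub_le_iff]
  constructor <;> linarith [(hf (hyp θ (D i).1) (D i).2).1, (hf (hyp θ' (D i).1) (D i).2).1]

theorem radius_le_slopeAsymmetry_mul (hf : ∀ z y, f z y ∈ Set.Icc (0 : ℝ) 1)
    (hK : slopeAsymmetry hyp f D S ≠ ∞) {C : Set Θ} {θ₀ : Θ} {ε : ℝ} (hε : 0 ≤ ε)
    (hC : ∀ θ ∈ C, risk hyp f D S θ ≤ risk hyp f D S θ₀ + ε) :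
    radius hyp f D S C θ₀ ≤
      2 * ((slopeAsymmetry hyp f D S).toReal * (risk hyp f D S θ₀ + ε)) := by
  have hR := risk_nonneg (hyp := hyp) (D := D) (S := S) hf θ₀
  refine Real.iSup_le (fun θ => (hypDist_le_slopeAsymmetry_mul hf hK θ θ₀).trans ?_)
    (by positivity)
  rw [mul_left_comm]
  gcongr
  linarith [hC θ θ.2]

theorem ofReal_radius_mul_disagreementAt_le (hf : ∀ z y, f z y ∈ Set.Icc (0 : ℝ) 1)
    {C : Set Θ} {θ₀ : Θ} {ε : ℝ} (hε : 0 < ε)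
    (hC : ∀ θ ∈ C, risk hyp f D S θ ≤ risk hyp f D S θ₀ + ε) :
    ENNReal.ofReal (2 * (radius hyp f D S C θ₀ *
        disagreementAt hyp f D S θ₀ (radius hyp f D S C θ₀))) ≤
      4 * ENNReal.ofReal (disagreementAt hyp f D S θ₀ (radius hyp f D S C θ₀)) *
        slopeAsymmetry hyp f D S * ENNReal.ofReal (risk hyp f D S θ₀ + ε) := by
  have hr := radius_nonneg (hyp := hyp) (f := f) (D := D) (S := S) C θ₀
  have hR := risk_nonneg (hyp := hyp) (D := D) (S := S) hf θ₀
  rcases (disagreementAt_nonneg (hyp := hyp) (f := f) (D := D) (S := S) θ₀ hr).eq_or_lt'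
    with hϑ | hϑ
  · simp [hϑ]
  -- an infinite slope asymmetry makes the bound infinite, because `ε` is positive
  by_cases hK : slopeAsymmetry hyp f D S = ∞
  · have h1 : ENNReal.ofReal (disagreementAt hyp f D S θ₀ (radius hyp f D S C θ₀)) ≠ 0 := by
      simpa using hϑ
    have h2 : ENNReal.ofReal (risk hyp f D S θ₀ + ε) ≠ 0 := by
      simpa using by linarith
    rw [hK, ENNReal.mul_top (mul_ne_zero four_ne_zero h1), ENNReal.top_mul h2]
    exact le_top
  · rw [← ENNReal.ofReal_toReal hK, ← ENNReal.ofReal_ofNat 4, ← ENNReal.ofReal_mul (by norm_num),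
      ← ENNReal.ofReal_mul (by positivity), ← ENNReal.ofReal_mul (by positivity)]
    refine ENNReal.ofReal_le_ofReal ?_
    have h := mul_le_mul_of_nonneg_left (radius_le_slopeAsymmetry_mul hf hK hε.le hC) hϑ.le
    linarith

theorem ofReal_disagreementAt_le_disagreementCoeff (θ₀ : Θ) {r : ℝ} (hr : 0 ≤ r) :
    ENNReal.ofReal (disagreementAt hyp f D S θ₀ r) ≤ disagreementCoeff hyp f D S θ₀ := by
  rcases hr.eq_or_lt' with rfl | hr
  · simp [disagreementAt]
  · exact le_iSup₂_of_le r hr le_rfl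

end SurrogateLearning

end

open SurrogateLearning in
theorem theorem2 {Θ X Y Z Ω : Type*} [Finite Θ] {n : ℕ}
    -- hypotheses, a loss with values in `[0, 1]`, the training set and a nonempty surrogate of it
    (hyp : Θ → X → Z) (f : Z → Y → ℝ) (hf : ∀ z y, f z y ∈ Set.Icc (0 : ℝ) 1)
    (D : Fin n → X × Y) (S : Finset (Fin n)) (hS : S.Nonempty)
    -- the optimal hypothesis on the surrogate
    (θstar : Θ) (hstar : ∀ θ, risk hyp f D S θstar ≤ risk hyp f D S θ)
    -- `d` bounds the number of patterns on the training set and `d / 2 ^ (n - T)` that on the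
    -- surrogate; for `d = 2 ^ n` the latter is `2 ^ T`
    (d : ℝ) (T : ℕ) (hd : (patternCount hyp D Finset.univ : ℝ) ≤ d)
    (hdS : (patternCount hyp D S : ℝ) ≤ d / 2 ^ ((n : ℤ) - (T : ℤ)))
    (δ : ℝ) (hδ : 0 < δ)
    -- independent rounds
    [MeasurableSpace Ω] (P : Measure Ω) [IsProbabilityMeasure P] (W : ℕ → Ω → S × I)
    (hWm : ∀ k, Measurable (W k)) (hWi : iIndepFun W P) (hWl : ∀ k, P.map (W k) = roundLaw S) :
    ENNReal.ofReal (1 - δ) ≤ P {ω | ∀ t : ℕ, 2 ≤ t →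
      -- the candidates in round `t`, that is, after `t - 1` rounds
      let C : Set Θ := (learnerRun hyp f D (d / 2 ^ ((n : ℤ) - (T : ℤ))) δ
        (fun k => W k ω) (t - 1)).cand
      let ε : ℝ := 2 * √(8 / ((t : ℝ) - 1) *
        Real.log (2 * ((t : ℝ) ^ 2 - (t : ℝ)) * (d / 2 ^ ((n : ℤ) - (T : ℤ))) / δ))
      let bound : ENNReal → ENNReal := fun ϑ =>
        4 * ϑ * slopeAsymmetry hyp f D S * ENNReal.ofReal (risk hyp f D S θstar + ε)
      let ϑr : ENNReal :=
        ENNReal.ofReal (disagreementAt hyp f D S θstar (radius hyp f D S C θstar))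
      θstar ∈ C ∧
      (∀ θ ∈ C, risk hyp f D S θ ≤ risk hyp f D S θstar + ε) ∧
      (∀ θ ∈ C, ENNReal.ofReal (2 * hypDist hyp f D S θ θstar) ≤ bound ϑr) ∧
      ENNReal.ofReal (labelCost hyp f D S C) ≤ bound ϑr ∧
      bound ϑr ≤ bound (disagreementCoeff hyp f D S θstar)} := by
  -- for `δ > 1` there is nothing to show; for `δ ≤ 1` the logarithms are positive
  rcases lt_or_ge 1 δ with hδ1 | hδ1
  · rw [ENNReal.ofReal_of_nonpos (by linarith)]
    exact zero_le
  set N : ℝ := d / 2 ^ ((n : ℤ) - (T : ℤ))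
  have : Nonempty Θ := ⟨θstar⟩
  have hN1 : 1 ≤ N := le_trans (by exact_mod_cast one_le_patternCount) hdS
  have hbad := measure_deviation_le hf hS θstar hdS hδ hδ1 hWm hWi hWl
  -- outer measure suffices: the event and the large deviations cover the space
  rw [ENNReal.ofReal_sub _ hδ.le, ENNReal.ofReal_one, tsub_le_iff_right]
  refine le_trans ?_ (add_le_add_right hbad _)
  rw [← measure_univ (μ := P)]
  refine (measure_mono fun ω _ => ?_).trans (measure_union_le _ _)
  refine or_iff_not_imp_right.2 fun hω t ht => ?_
  simp only [Set.mem_ofPred_eq, not_exists, not_le] at hω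
  obtain ⟨k, rfl⟩ : ∃ k, t = k + 1 + 1 := ⟨t - 2, by omega⟩
  have hε : 2 * √(8 / (((k + 1 + 1 : ℕ) : ℝ) - 1) *
      Real.log (2 * (((k + 1 + 1 : ℕ) : ℝ) ^ 2 - ((k + 1 + 1 : ℕ) : ℝ)) * N / δ)) =
      2 * slack N δ (k + 1) := by
    rw [slack]; push_cast; ring_nf
  intro C ε bound ϑr
  have hC : ∀ θ ∈ C, risk hyp f D S θ ≤ risk hyp f D S θstar + ε := fun θ hθ =>
    (risk_le_of_mem_cand hf hω hstar k hθ).trans_eq (by rw [← hε])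
  have hε0 : 0 < ε := (mul_pos two_pos (slack_pos hN1 hδ hδ1 k)).trans_eq hε.symm
  have hbound := ofReal_radius_mul_disagreementAt_le hf hε0 hC
  refine ⟨optimal_mem_cand hf hω hstar (k + 1), hC, fun θ hθ => le_trans ?_ hbound,
    le_trans ?_ hbound, ?_⟩
  · exact ENNReal.ofReal_le_ofReal (mul_le_mul_of_nonneg_left
      (hypDist_le_radius_mul_disagreementAt θstar hθ) zero_le_two)
  · exact ENNReal.ofReal_le_ofReal (labelCost_le_radius_mul_disagreementAt hf hS C θstar)
  · have := ofReal_disagreementAt_le_disagreementCoeff (hyp := hyp) (f := f) (D := D) (S := S)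
      θstar (radius_nonneg (hyp := hyp) (f := f) (D := D) (S := S) C θstar)
    simp only [bound, ϑr]
    gcongr
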